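/- Let $N,p,\alpha$ be positive integers and let $F$ be a $\mathbb C^N$-valued map that is analytic at $(0,0,0)\in\mathbb C\times\mathbb C\times\mathbb C^N$, with $F(0,0,0)=0$ and with invertible Jacobian matrix $D_yF(0,0,0)$. Consider the doubly-singular system $$\epsilon^{\alpha}x^{p+1}\frac{\partial y}{\partial x}=F(x,\epsilon,y).$$ Then the system has a unique formal power series solution $\hat y=\sum_{n,m\ge 0}a_{n,m}x^n\epsilon^m\in\mathbb C[[x,\epsilon]]^N$ with $\hat y(0,0)=0$ (so that the Taylor series of $F$ at the origin can be composed formally with $(x,\epsilon,\hat y)$). Moreover, $\hat y$ is $1$-Gevrey in the monomial $x^p\epsilon^{\alpha}$, i.e. there are constants $C,A>0$ such that, for all $n,m\ge 0$, $$|a_{n,m}|\le C A^{n+m}\min\{n!^{1/p},\,m!^{1/\alpha}\}.$$ -/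

import Mathlib

open scoped Nat Topology

noncomputable section

namespace DoublySingular

/-- The coefficient of the multi-index `d` in the Taylor expansion of `f` at `0`, in the coordinates
given by the vectors `e i`: the mixed partial derivative `∂^d f (0)`, in which the direction `e i`
is used `d i` times, divided by `d! = ∏ i, (d i)!`. The list `l` enumerates these directions (for
an analytic `f` their order is irrelevant). -/
def taylorCoeff {σ E : Type*} [NormedAddCommGroup E] [NormedSpace ℂ E]
    (e : σ → E) (f : E → ℂ) (d : σ →₀ ℕ) : ℂ :=
  let l : List σ := (Finsupp.toMultiset d).toList
  (d.prod fun _ k => (k ! : ℂ))⁻¹ * iteratedFDeriv ℂ l.length f 0 (fun k => e (l.get k))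

/-- The Taylor series of `f` at `0`, as a formal power series in the coordinates given by `e`. -/
def taylorSeries {σ E : Type*} [NormedAddCommGroup E] [NormedSpace ℂ E]
    (e : σ → E) (f : E → ℂ) : MvPowerSeries σ ℂ :=
  fun d => taylorCoeff e f d

/-- The coordinate directions of `ℂ × ℂ × ℂ^N`, whose points are written `(x, ε, y)`:
`inl 0` is the `x`-direction, `inl 1` the `ε`-direction, `inr j` the `y_j`-direction. -/
def coordVec (N : ℕ) : Fin 2 ⊕ Fin N → ℂ × ℂ × (Fin N → ℂ) :=
  Sum.elim ![(1, 0, 0), (0, 1, 0)] (fun j => (0, 0, Pi.single j 1))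

/-- The formal variable `x` of `ℂ[[x, ε]]`. -/
abbrev xVar : MvPowerSeries (Fin 2) ℂ := MvPowerSeries.X 0

/-- The formal variable `ε` of `ℂ[[x, ε]]`. -/
abbrev epsVar : MvPowerSeries (Fin 2) ℂ := MvPowerSeries.X 1

/-- The `j`-th component of the formal composition `F(x, ε, ŷ(x, ε))`, that is, of the Taylor
series of `F` at the origin with `x`, `ε`, `ŷ` put in for its variables. -/
def formalComp {N : ℕ} (F : ℂ × ℂ × (Fin N → ℂ) → (Fin N → ℂ))
    (y : Fin N → MvPowerSeries (Fin 2) ℂ) (j : Fin N) : MvPowerSeries (Fin 2) ℂ :=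
  MvPowerSeries.subst (Sum.elim ![xVar, epsVar] y) (taylorSeries (coordVec N) (fun z => F z j))

/-- `ŷ ∈ ℂ[[x, ε]]^N` is a formal power series solution of `ε^α x^(p+1) ∂y/∂x = F(x, ε, y)`.
The condition `ŷ(0, 0) = 0` is what gives the formal composition `F(x, ε, ŷ)` a meaning. -/
structure IsFormalSolution {N : ℕ} (p α : ℕ) (F : ℂ × ℂ × (Fin N → ℂ) → (Fin N → ℂ))
    (y : Fin N → MvPowerSeries (Fin 2) ℂ) : Prop where
  constantCoeff_eq_zero : ∀ j, MvPowerSeries.constantCoeff (y j) = 0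
  equation : ∀ j,
    epsVar ^ α * xVar ^ (p + 1) * MvPowerSeries.pderiv ℂ 0 (y j) = formalComp F y j

/-- The vector `a_{n,m} ∈ ℂ^N` of coefficients of `x^n ε^m` in `ŷ`. -/
def coeffVec {N : ℕ} (y : Fin N → MvPowerSeries (Fin 2) ℂ) (n m : ℕ) : Fin N → ℂ :=
  fun j => MvPowerSeries.coeff (Finsupp.single 0 n + Finsupp.single 1 m) (y j)

/-- `ŷ = ∑ a_{n,m} x^n ε^m` is `1`-Gevrey in the monomial `x^p ε^α`. -/
def IsMonomialGevrey {N : ℕ} (p α : ℕ) (y : Fin N → MvPowerSeries (Fin 2) ℂ) : Prop :=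
  ∃ C A : ℝ, 0 < C ∧ 0 < A ∧ ∀ n m : ℕ,
    ‖coeffVec y n m‖ ≤
      C * A ^ (n + m) * min ((n ! : ℝ) ^ (1 / (p : ℝ))) ((m ! : ℝ) ^ (1 / (α : ℝ)))

end DoublySingular

end

/-! With `L` the inverse of `A = D_yF(0,0,0)`, the system reads `y = L ε^α x^(p+1) ∂y/∂x + g(x, ε,
y)`, where `g = y - L F` has no constant term and no linear term in `y`. Its right side, `fixMap`,
raises the order of contact of two series by one, so it has exactly one formal fixed point, the
limit of the iterates from `0` (`exists_fixMap_eq`, `fixMap_eq_unique`).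

For the Gevrey bound, fix the index `D = (n, m)` and use a weighted `ℓ¹` seminorm cut off at `D`. It
is submultiplicative, and `x ∂/∂x` costs only a factor `n`, so the singular term has norm at most a
constant times `n ρ^p σ^α`. If the weights make this small, a fixed small ball is invariant and
contains all iterates (`truncNorm_iterate_fixMap_le`). The weights may depend on `(n, m)`: shrinking
`ρ` by `(n+1)^(1/p)` gives the bound with `n!^(1/p)`, and shrinking `σ` by `(n+1)^(1/α)` gives the
one with `m!^(1/α)`, because `(n+1)^m ≤ m! e^(n+1)`. -/

namespace DoublySingular

/-! ### Truncated weighted norms -/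

open MvPowerSeries

/-- The weighted `ℓ¹` seminorm, with weights `ρ` and `σ`, of the coefficients with index at
most `D`. -/
noncomputable def truncNorm (ρ σ : ℝ) (D : Fin 2 →₀ ℕ) (f : MvPowerSeries (Fin 2) ℂ) : ℝ :=
  ∑ d ∈ Finset.Iic D, ‖coeff d f‖ * (ρ ^ d 0 * σ ^ d 1)

section TruncNorm

variable {ρ σ : ℝ} {D : Fin 2 →₀ ℕ}

theorem truncNorm_nonneg (hρ : 0 ≤ ρ) (hσ : 0 ≤ σ) (f : MvPowerSeries (Fin 2) ℂ) :
    0 ≤ truncNorm ρ σ D f :=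
  Finset.sum_nonneg fun _ _ => by positivity

theorem truncNorm_zero : truncNorm ρ σ D 0 = 0 := by simp [truncNorm]

theorem truncNorm_add_le (hρ : 0 ≤ ρ) (hσ : 0 ≤ σ) (f g : MvPowerSeries (Fin 2) ℂ) :
    truncNorm ρ σ D (f + g) ≤ truncNorm ρ σ D f + truncNorm ρ σ D g := by
  rw [truncNorm, truncNorm, truncNorm, ← Finset.sum_add_distrib]
  refine Finset.sum_le_sum fun d _ => ?_
  rw [← add_mul, map_add]
  gcongr
  exact norm_add_le _ _

theorem truncNorm_sum_le (hρ : 0 ≤ ρ) (hσ : 0 ≤ σ) {ι : Type*} (s : Finset ι)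
    (f : ι → MvPowerSeries (Fin 2) ℂ) :
    truncNorm ρ σ D (∑ i ∈ s, f i) ≤ ∑ i ∈ s, truncNorm ρ σ D (f i) :=
  Finset.le_sum_of_subadditive _ truncNorm_zero.le (truncNorm_add_le hρ hσ) s f

theorem truncNorm_smul (c : ℂ) (f : MvPowerSeries (Fin 2) ℂ) :
    truncNorm ρ σ D (c • f) = ‖c‖ * truncNorm ρ σ D f := by
  simp [truncNorm, Finset.mul_sum, mul_assoc]

theorem truncNorm_monomial_le (hρ : 0 ≤ ρ) (hσ : 0 ≤ σ) (d : Fin 2 →₀ ℕ) (c : ℂ) :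
    truncNorm ρ σ D (monomial d c) ≤ ‖c‖ * (ρ ^ d 0 * σ ^ d 1) := by
  classical
  rw [truncNorm]
  simp only [coeff_monomial]
  by_cases hd : d ∈ Finset.Iic D
  · rw [Finset.sum_eq_single_of_mem d hd]
    · simp
    · intro b _ hb
      simp [hb]
  · rw [Finset.sum_eq_zero]
    · positivity
    · intro b hb
      have : b ≠ d := fun h => hd (h ▸ hb)
      simp [this]

theorem truncNorm_one_le (hρ : 0 ≤ ρ) (hσ : 0 ≤ σ) : truncNorm ρ σ D 1 ≤ 1 := by
  simpa using truncNorm_monomial_le (D := D) hρ hσ 0 1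

/-- The index set is closed downwards: both parts of a splitting of `d ≤ D` are again at most `D`,
so truncation is compatible with the Cauchy product. -/
theorem truncNorm_mul_le (hρ : 0 ≤ ρ) (hσ : 0 ≤ σ) (f g : MvPowerSeries (Fin 2) ℂ) :
    truncNorm ρ σ D (f * g) ≤ truncNorm ρ σ D f * truncNorm ρ σ D g := by
  classical
  let F : (Fin 2 →₀ ℕ) × (Fin 2 →₀ ℕ) → ℝ := fun q =>
    (‖coeff q.1 f‖ * (ρ ^ q.1 0 * σ ^ q.1 1)) * (‖coeff q.2 g‖ * (ρ ^ q.2 0 * σ ^ q.2 1))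
  have hF : ∀ q, 0 ≤ F q := fun q => by positivity
  calc truncNorm ρ σ D (f * g)
      ≤ ∑ d ∈ Finset.Iic D, ∑ q ∈ Finset.HasAntidiagonal.antidiagonal d, F q := by
        refine Finset.sum_le_sum fun d _ => ?_
        rw [coeff_mul]
        calc _ ≤ (∑ q ∈ Finset.HasAntidiagonal.antidiagonal d, ‖coeff q.1 f * coeff q.2 g‖)
              * (ρ ^ d 0 * σ ^ d 1) := by
              gcongr
              exact norm_sum_le _ _
          _ = _ := by
              rw [Finset.sum_mul]
              refine Finset.sum_congr rfl fun q hq => ?_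
              rw [Finset.HasAntidiagonal.mem_antidiagonal] at hq
              rw [← hq, norm_mul]
              simp only [F, Finsupp.add_apply, pow_add]
              ring
    _ = ∑ q ∈ (Finset.Iic D).biUnion Finset.HasAntidiagonal.antidiagonal, F q := by
        rw [Finset.sum_biUnion]
        intro a _ b _ hab
        refine Finset.disjoint_left.2 fun q hqa hqb => hab ?_
        rw [Finset.HasAntidiagonal.mem_antidiagonal] at hqa hqb
        exact hqa.symm.trans hqb
    _ ≤ ∑ q ∈ Finset.Iic D ×ˢ Finset.Iic D, F q := by
        refine Finset.sum_le_sum_of_subset_of_nonneg ?_ fun q _ _ => hF q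
        intro q hq
        simp only [Finset.mem_biUnion, Finset.mem_Iic, Finset.HasAntidiagonal.mem_antidiagonal,
          Finset.mem_product] at hq ⊢
        obtain ⟨d, hd, rfl⟩ := hq
        exact ⟨le_self_add.trans hd, le_add_self.trans hd⟩
    _ = _ := by
        rw [Finset.sum_product, truncNorm, truncNorm, Finset.sum_mul_sum]

theorem truncNorm_pow_le (hρ : 0 ≤ ρ) (hσ : 0 ≤ σ) (f : MvPowerSeries (Fin 2) ℂ) (n : ℕ) :
    truncNorm ρ σ D (f ^ n) ≤ truncNorm ρ σ D f ^ n := by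
  induction n with
  | zero => simpa using truncNorm_one_le hρ hσ
  | succ n ih =>
    rw [pow_succ, pow_succ]
    exact (truncNorm_mul_le hρ hσ _ _).trans
      (mul_le_mul_of_nonneg_right ih (truncNorm_nonneg hρ hσ f))

theorem truncNorm_prod_le (hρ : 0 ≤ ρ) (hσ : 0 ≤ σ) {ι : Type*} (s : Finset ι)
    (f : ι → MvPowerSeries (Fin 2) ℂ) :
    truncNorm ρ σ D (∏ i ∈ s, f i) ≤ ∏ i ∈ s, truncNorm ρ σ D (f i) := by
  classical
  induction s using Finset.induction_on with
  | empty => simpa using truncNorm_one_le hρ hσ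
  | insert a s ha ih =>
    rw [Finset.prod_insert ha, Finset.prod_insert ha]
    exact (truncNorm_mul_le hρ hσ _ _).trans
      (mul_le_mul_of_nonneg_left ih (truncNorm_nonneg hρ hσ _))

theorem norm_coeff_mul_le_truncNorm (hρ : 0 ≤ ρ) (hσ : 0 ≤ σ) (f : MvPowerSeries (Fin 2) ℂ) :
    ‖coeff D f‖ * (ρ ^ D 0 * σ ^ D 1) ≤ truncNorm ρ σ D f :=
  Finset.single_le_sum (f := fun d => ‖coeff d f‖ * (ρ ^ d 0 * σ ^ d 1))
    (fun _ _ => by positivity) (Finset.mem_Iic.2 le_rfl)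

/-- The Euler derivation `x ∂/∂x` costs at most a factor `D 0` in the truncated norm. -/
theorem truncNorm_X_mul_pderiv_le (hρ : 0 ≤ ρ) (hσ : 0 ≤ σ) (f : MvPowerSeries (Fin 2) ℂ) :
    truncNorm ρ σ D (X 0 * pderiv ℂ 0 f) ≤ D 0 * truncNorm ρ σ D f := by
  classical
  rw [truncNorm, truncNorm, Finset.mul_sum]
  refine Finset.sum_le_sum fun d hd => ?_
  rw [← mul_assoc (D 0 : ℝ)]
  refine mul_le_mul_of_nonneg_right ?_ (by positivity)
  have hdD : d ≤ D := Finset.mem_Iic.1 hd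
  have hD : d 0 ≤ D 0 := hdD 0
  rw [X, coeff_monomial_mul]
  split_ifs with h
  · rw [coeff_pderiv, tsub_add_cancel_of_le h, one_mul, norm_mul, mul_comm]
    have h1 : 1 ≤ d 0 := Finsupp.single_le_iff.1 h
    gcongr
    rw [show (((d - Finsupp.single 0 1 : Fin 2 →₀ ℕ) 0 : ℕ) : ℂ) + 1 = ((d 0 : ℕ) : ℂ) by
      rw [Finsupp.tsub_apply, Finsupp.single_eq_same, Nat.cast_sub h1]
      simp]
    rw [Complex.norm_natCast]
    exact_mod_cast hD
  · simp only [norm_zero]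
    positivity

theorem truncNorm_singular_le (hρ : 0 ≤ ρ) (hσ : 0 ≤ σ) (p α : ℕ)
    (f : MvPowerSeries (Fin 2) ℂ) :
    truncNorm ρ σ D (epsVar ^ α * xVar ^ (p + 1) * pderiv ℂ 0 f) ≤
      D 0 * (ρ ^ p * σ ^ α) * truncNorm ρ σ D f := by
  have hx : truncNorm ρ σ D xVar ≤ ρ := by
    simpa [X] using truncNorm_monomial_le (D := D) hρ hσ (Finsupp.single 0 1) 1
  have he : truncNorm ρ σ D epsVar ≤ σ := by
    simpa [X] using truncNorm_monomial_le (D := D) hρ hσ (Finsupp.single 1 1) 1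
  have h0 := fun f => truncNorm_nonneg (D := D) hρ hσ f
  calc truncNorm ρ σ D (epsVar ^ α * xVar ^ (p + 1) * pderiv ℂ 0 f)
      = truncNorm ρ σ D (epsVar ^ α * (xVar ^ p * (X 0 * pderiv ℂ 0 f))) := by
        congr 1
        ring
    _ ≤ σ ^ α * (ρ ^ p * (D 0 * truncNorm ρ σ D f)) := by
        refine (truncNorm_mul_le hρ hσ _ _).trans (mul_le_mul ?_ ?_ (h0 _) (by positivity))
        · exact (truncNorm_pow_le hρ hσ _ _).trans (pow_le_pow_left₀ (h0 _) he _)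
        · refine (truncNorm_mul_le hρ hσ _ _).trans (mul_le_mul ?_ ?_ (h0 _) (by positivity))
          · exact (truncNorm_pow_le hρ hσ _ _).trans (pow_le_pow_left₀ (h0 _) hx _)
          · exact truncNorm_X_mul_pderiv_le hρ hσ f
    _ = _ := by ring

/-- A substitution is bounded by the corresponding substitution into the series of absolute
values. -/
theorem truncNorm_subst_le (hρ : 0 ≤ ρ) (hσ : 0 ≤ σ) {ι : Type*} [Fintype ι]
    {u : ι → MvPowerSeries (Fin 2) ℂ} (hu : HasSubst u) (g : MvPowerSeries ι ℂ)
    {b : (ι →₀ ℕ) → ℝ} {M : ℝ} (hM : ∀ T : Finset (ι →₀ ℕ), ∑ k ∈ T, b k ≤ M)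
    (hb : ∀ k, ‖coeff k g‖ * ∏ i, truncNorm ρ σ D (u i) ^ k i ≤ b k) :
    truncNorm ρ σ D (subst u g) ≤ M := by
  classical
  -- Only finitely many monomials of `g` reach the coefficients up to `D`, so the substitution may
  -- be replaced by a finite sum.
  let t : (Fin 2 →₀ ℕ) → Finset (ι →₀ ℕ) := fun d => (coeff_subst_finite hu g d).toFinset
  let T := (Finset.Iic D).biUnion t
  have hprod : ∀ k : ι →₀ ℕ, (k.prod fun s e => u s ^ e) = ∏ i, u i ^ k i := fun k =>
    k.prod_fintype _ (by simp)
  have hcoeff : ∀ d ∈ Finset.Iic D, coeff d (subst u g) =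
      coeff d (∑ k ∈ T, coeff k g • ∏ i, u i ^ k i) := by
    intro d hd
    rw [coeff_subst hu, finsum_eq_sum_of_support_subset (s := T), map_sum]
    · simp [hprod]
    · intro k hk
      exact Finset.mem_coe.2 (Finset.mem_biUnion.2 ⟨d, hd, by simpa [t] using hk⟩)
  calc truncNorm ρ σ D (subst u g)
      = truncNorm ρ σ D (∑ k ∈ T, coeff k g • ∏ i, u i ^ k i) :=
        Finset.sum_congr rfl fun d hd => by rw [hcoeff d hd]
    _ ≤ ∑ k ∈ T, truncNorm ρ σ D (coeff k g • ∏ i, u i ^ k i) := truncNorm_sum_le hρ hσ _ _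
    _ ≤ ∑ k ∈ T, b k := by
        refine Finset.sum_le_sum fun k _ => le_trans ?_ (hb k)
        rw [truncNorm_smul]
        refine mul_le_mul_of_nonneg_left ?_ (norm_nonneg _)
        refine (truncNorm_prod_le hρ hσ _ _).trans ?_
        exact Finset.prod_le_prod (fun _ _ => truncNorm_nonneg hρ hσ _)
          fun _ _ => truncNorm_pow_le hρ hσ _ _
    _ ≤ M := hM T

end TruncNorm

/-! ### Order of contact under substitution -/

section Order

variable {τ ι : Type*} [Fintype ι]

theorem one_le_order_prod_pow {u : ι → MvPowerSeries τ ℂ} (hu : ∀ i, constantCoeff (u i) = 0)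
    {d : ι →₀ ℕ} (hd : d ≠ 0) : 1 ≤ (∏ i, u i ^ d i).order := by
  obtain ⟨i, hi⟩ := Finsupp.ne_iff.1 hd
  rw [one_le_order_iff_constCoeff_eq_zero, map_prod]
  exact Finset.prod_eq_zero (Finset.mem_univ i) (by rw [map_pow, hu i, zero_pow hi])

theorem le_order_add {f g : MvPowerSeries τ ℂ} {k : ℕ∞} (hf : k ≤ f.order) (hg : k ≤ g.order) :
    k ≤ (f + g).order :=
  (le_min hf hg).trans min_order_le_add

theorem le_order_sum {κ : Type*} (s : Finset κ) {f : κ → MvPowerSeries τ ℂ} {k : ℕ∞}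
    (hf : ∀ i ∈ s, k ≤ (f i).order) : k ≤ (∑ i ∈ s, f i).order := by
  refine Finset.sum_induction f (fun g => k ≤ g.order) (fun _ _ => le_order_add) ?_ hf
  simp

theorem le_order_prod_pow_sub {u v : ι → MvPowerSeries τ ℂ} {k : ℕ∞}
    (h : ∀ i, k ≤ (u i - v i).order) (d : ι → ℕ) :
    k ≤ (∏ i, u i ^ d i - ∏ i, v i ^ d i).order := by
  have hmul : ∀ a b a' b' : MvPowerSeries τ ℂ, k ≤ (a - a').order → k ≤ (b - b').order →
      k ≤ (a * b - a' * b').order := by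
    intro a b a' b' ha hb
    rw [show a * b - a' * b' = (a - a') * b + a' * (b - b') by ring]
    exact le_order_add ((ha.trans le_self_add).trans le_order_mul)
      ((hb.trans le_add_self).trans le_order_mul)
  have hpow : ∀ i n, k ≤ (u i ^ n - v i ^ n).order := by
    intro i n
    induction n with
    | zero => simp
    | succ n ih =>
      rw [pow_succ, pow_succ]
      exact hmul _ _ _ _ ih (h i)
  classical
  refine Finset.induction_on (motive := fun s => k ≤ (∏ i ∈ s, u i ^ d i - ∏ i ∈ s, v i ^ d i).order)
    Finset.univ (by simp) fun i s hi ih => ?_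
  rw [Finset.prod_insert hi, Finset.prod_insert hi]
  exact hmul _ _ _ _ (hpow i _) ih

theorem eq_zero_or_exists_eq_single_add {κ : Type*} (d : κ →₀ ℕ) :
    d = 0 ∨ ∃ i d', d = Finsupp.single i 1 + d' := by
  refine or_iff_not_imp_left.2 fun hd => ?_
  obtain ⟨i, hi⟩ := Finsupp.ne_iff.1 hd
  exact ⟨i, d - Finsupp.single i 1, (add_tsub_cancel_of_le (by
    simpa [Finsupp.single_le_iff] using Nat.one_le_iff_ne_zero.2 hi)).symm⟩

theorem prod_pow_single_add {R : Type*} [CommMonoid R] (u : ι → R) (i : ι) (d : ι →₀ ℕ) :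
    ∏ j, u j ^ (Finsupp.single i 1 + d : ι →₀ ℕ) j = u i * ∏ j, u j ^ d j := by
  classical
  simp only [Finsupp.add_apply, pow_add, Finset.prod_mul_distrib]
  congr 1
  rw [Finset.prod_eq_single i (fun j _ hj => by simp [hj.symm])
    (by simp)]
  simp

/-- In `u U - v V = (u - v) U + v (U - V)` each term pairs a difference of order `k` with a factor
vanishing at the origin; `U` vanishes there because `d ≠ 0`. -/
theorem add_one_le_order_prod_pow_sub {u v : ι → MvPowerSeries τ ℂ} {k : ℕ∞}
    (hu : ∀ i, constantCoeff (u i) = 0) (hv : ∀ i, constantCoeff (v i) = 0)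
    (h : ∀ i, k ≤ (u i - v i).order) (i : ι) {d : ι →₀ ℕ} (hd : d ≠ 0) :
    k + 1 ≤ (∏ j, u j ^ (Finsupp.single i 1 + d : ι →₀ ℕ) j -
      ∏ j, v j ^ (Finsupp.single i 1 + d : ι →₀ ℕ) j).order := by
  rw [prod_pow_single_add, prod_pow_single_add,
    show u i * ∏ j, u j ^ d j - v i * ∏ j, v j ^ d j =
    (u i - v i) * ∏ j, u j ^ d j + v i * (∏ j, u j ^ d j - ∏ j, v j ^ d j) by ring]
  refine le_order_add ?_ ?_
  · exact (add_le_add (h i) (one_le_order_prod_pow hu hd)).trans le_order_mul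
  · rw [add_comm]
    exact (add_le_add (one_le_order_iff_constCoeff_eq_zero.2 (hv i))
      (le_order_prod_pow_sub h d)).trans le_order_mul

/-- Substitution into `g` increases the order of contact of `u` and `v`, if the only linear terms
of `g` are in variables for which `u` and `v` agree. -/
theorem add_one_le_order_subst_sub {u v : ι → MvPowerSeries τ ℂ} {k : ℕ∞}
    (hu : ∀ i, constantCoeff (u i) = 0) (hv : ∀ i, constantCoeff (v i) = 0)
    (h : ∀ i, k ≤ (u i - v i).order) (g : MvPowerSeries ι ℂ)
    (hg : ∀ i, u i = v i ∨ coeff (Finsupp.single i 1) g = 0) :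
    k + 1 ≤ (subst u g - subst v g).order := by
  refine le_order fun e he => ?_
  rw [map_sub, coeff_subst (hasSubst_of_constantCoeff_zero hu),
    coeff_subst (hasSubst_of_constantCoeff_zero hv), sub_eq_zero]
  refine finsum_congr fun d => ?_
  rw [d.prod_fintype _ (by simp), d.prod_fintype _ (by simp)]
  rcases eq_zero_or_exists_eq_single_add d with rfl | ⟨i, d', rfl⟩
  · simp
  rcases eq_or_ne d' 0 with rfl | hd'
  · rcases hg i with hi | hi
    · rw [prod_pow_single_add, prod_pow_single_add, hi]
      simp
    · simp [hi]
  · congr 1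
    rw [← sub_eq_zero, ← map_sub]
    exact coeff_of_lt_order (he.trans_le (add_one_le_order_prod_pow_sub hu hv h i hd'))

end Order

end DoublySingular

/-! ### Cauchy estimates for Taylor coefficients -/

namespace DoublySingular

/-- The geometric series in several variables converges. -/
theorem summable_pow_degree {ι : Type*} [Fintype ι] {r : ℝ} (h0 : 0 ≤ r) (h1 : r < 1) :
    Summable fun k : ι →₀ ℕ => r ^ k.degree := by
  classical
  refine summable_of_sum_le (c := ∏ _i : ι, (1 - r)⁻¹) (fun k => by positivity) fun T => ?_
  have hdeg : ∀ k : ι →₀ ℕ, r ^ k.degree = ∏ i, r ^ k i := fun k => by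
    rw [Finset.prod_pow_eq_pow_sum, Finsupp.degree_eq_sum]
  let n := T.sup Finsupp.degree + 1
  calc ∑ k ∈ T, r ^ k.degree
      = ∑ f ∈ T.map Finsupp.equivFunOnFinite.toEmbedding, ∏ i, r ^ f i := by
        rw [Finset.sum_map]
        exact Finset.sum_congr rfl fun k _ => hdeg k
    _ ≤ ∑ f ∈ Fintype.piFinset fun _ : ι => Finset.range n, ∏ i, r ^ f i := by
        refine Finset.sum_le_sum_of_subset_of_nonneg ?_ fun _ _ _ => by positivity
        intro f hf
        obtain ⟨k, hk, rfl⟩ := Finset.mem_map.1 hf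
        refine Fintype.mem_piFinset.2 fun i => Finset.mem_range.2 (Nat.lt_succ_of_le ?_)
        exact (Finsupp.le_degree i k).trans (Finset.le_sup hk)
    _ = ∏ _i : ι, ∑ j ∈ Finset.range n, r ^ j := (Finset.prod_univ_sum _ _).symm
    _ ≤ ∏ _i : ι, (1 - r)⁻¹ := by
        refine Finset.prod_le_prod (fun _ _ => by positivity) fun _ _ => ?_
        rw [← tsum_geometric_of_lt_one h0 h1]
        exact (summable_geometric_of_lt_one h0 h1).sum_le_tsum _ fun _ _ => by positivity

/-- The multinomial coefficient of `k` is one term in the expansion of `(1 + ⋯ + 1)^|k|`. -/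
theorem factorial_degree_le {ι : Type*} [Fintype ι] (k : ι →₀ ℕ) :
    k.degree ! ≤ (∏ i, (k i)!) * Fintype.card ι ^ k.degree := by
  classical
  rw [Finsupp.degree_eq_sum, ← Nat.multinomial_spec Finset.univ k]
  refine Nat.mul_le_mul_left _ ?_
  have h := Finset.sum_pow_eq_sum_piAntidiag Finset.univ (fun _ : ι => 1) (∑ i, k i)
  simp only [Finset.sum_const, Finset.card_univ, smul_eq_mul, mul_one, one_pow,
    Finset.prod_const_one] at h
  rw [h]
  exact Finset.single_le_sum (f := fun k : ι → ℕ => Nat.multinomial Finset.univ k)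
    (fun _ _ => Nat.zero_le _) (by simp)

section Taylor

variable {ι E : Type*} [NormedAddCommGroup E] [NormedSpace ℂ E]

theorem taylorCoeff_zero (e : ι → E) (f : E → ℂ) : taylorCoeff e f 0 = f 0 := by
  have h : ∀ l : List ι, l = [] →
      iteratedFDeriv ℂ l.length f 0 (fun k => e (l.get k)) = f 0 := by
    rintro _ rfl
    exact iteratedFDeriv_zero_apply _
  simp only [taylorCoeff]
  rw [h _ (by simp)]
  simp

theorem taylorCoeff_single (e : ι → E) (f : E → ℂ) (i : ι) :
    taylorCoeff e f (Finsupp.single i 1) = fderiv ℂ f 0 (e i) := by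
  have h : ∀ l : List ι, l = [i] →
      iteratedFDeriv ℂ l.length f 0 (fun k => e (l.get k)) = fderiv ℂ f 0 (e i) := by
    rintro _ rfl
    exact iteratedFDeriv_one_apply _
  simp only [taylorCoeff]
  rw [h _ (by simp)]
  simp

/-- Cauchy estimates for the coefficients of the Taylor series of an analytic function. -/
theorem exists_norm_taylorCoeff_le [Fintype ι] {e : ι → E} (he : ∀ i, ‖e i‖ ≤ 1) {f : E → ℂ}
    (hf : AnalyticAt ℂ f 0) :
    ∃ C B : ℝ, 0 < C ∧ 0 < B ∧ ∀ k, ‖taylorCoeff e f k‖ ≤ C * B ^ k.degree := by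
  obtain ⟨P, r, hP⟩ := hf
  obtain ⟨C, b, hC, hb, hle⟩ := P.le_mul_pow_of_radius_pos (hP.r_pos.trans_le hP.r_le)
  -- The factor `card ι` pays for `|k|! / k!`; the `+ 1` keeps the constant positive when `ι` is
  -- empty.
  refine ⟨C, b * (Fintype.card ι + 1), hC, by positivity, fun k => ?_⟩
  have hlen : (Finsupp.toMultiset k).toList.length = k.degree := by
    rw [Multiset.length_toList, Finsupp.card_toMultiset]
    rfl
  have hder : ∀ (n : ℕ) (v : Fin n → E), (∀ i, ‖v i‖ ≤ 1) →
      ‖iteratedFDeriv ℂ n f 0 v‖ ≤ n ! * (C * b ^ n) := by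
    intro n v hv
    -- The derivative is the sum of `P n` over the `n!` permutations of its arguments.
    rw [hP.iteratedFDeriv_eq_sum_of_completeSpace]
    refine (norm_sum_le _ _).trans ((Finset.sum_le_card_nsmul _ _ (C * b ^ n) ?_).trans ?_)
    · intro s _
      refine ((P n).le_opNorm _).trans ((mul_le_of_le_one_right (norm_nonneg _) ?_).trans (hle n))
      exact Finset.prod_le_one (fun _ _ => norm_nonneg _) fun i _ => hv _
    · simp [Fintype.card_perm]
  have hfac : (0 : ℝ) < ∏ i, ((k i)! : ℝ) := Finset.prod_pos fun i _ => by positivity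
  have hnorm : ‖(k.prod fun _ m => (m ! : ℂ))⁻¹‖ = (∏ i, ((k i)! : ℝ))⁻¹ := by
    rw [k.prod_fintype _ (by simp), norm_inv, norm_prod]
    simp
  simp only [taylorCoeff]
  rw [norm_mul, hnorm]
  calc _ ≤ (∏ i, ((k i)! : ℝ))⁻¹ * (k.degree ! * (C * b ^ k.degree)) := by
        gcongr
        rw [← hlen]
        exact hder _ _ fun i => he _
    _ ≤ (∏ i, ((k i)! : ℝ))⁻¹ *
        (((∏ i, ((k i)! : ℝ)) * (Fintype.card ι : ℝ) ^ k.degree) * (C * b ^ k.degree)) := by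
        gcongr
        exact_mod_cast factorial_degree_le k
    _ = C * (b * Fintype.card ι) ^ k.degree := by
        rw [mul_pow]
        field_simp
    _ ≤ _ := by
        gcongr
        linarith

theorem exists_summable_norm_taylorCoeff [Fintype ι] {e : ι → E} (he : ∀ i, ‖e i‖ ≤ 1)
    {κ : Type*} [Finite κ] {f : κ → E → ℂ} (hf : ∀ j, AnalyticAt ℂ (f j) 0) :
    ∃ R : ℝ, 0 < R ∧ ∀ j, Summable fun k => ‖taylorCoeff e (f j) k‖ * R ^ k.degree := by
  cases nonempty_fintype κ
  choose C B hC hB hle using fun j => exists_norm_taylorCoeff_le he (hf j)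
  have hB' : 0 ≤ ∑ j, B j := Finset.sum_nonneg fun j _ => (hB j).le
  -- This radius gives `B j * R ≤ 1/2` for every `j`, hence a geometric majorant.
  refine ⟨(2 * (∑ j, B j + 1))⁻¹, by positivity, fun j => ?_⟩
  refine Summable.of_nonneg_of_le (fun k => by positivity) (fun k => ?_)
    ((summable_pow_degree (ι := ι) (r := 1 / 2) (by norm_num) (by norm_num)).mul_left (C j))
  refine (mul_le_mul_of_nonneg_right (hle j k) (by positivity)).trans ?_
  rw [mul_assoc, ← mul_pow]
  have h1 : 0 ≤ C j := (hC j).le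
  have h2 : 0 ≤ B j := (hB j).le
  gcongr
  rw [← div_eq_mul_inv, div_le_div_iff₀ (by positivity) (by norm_num)]
  have := Finset.single_le_sum (f := B) (fun i _ => (hB i).le) (Finset.mem_univ j)
  linarith

end Taylor

end DoublySingular

namespace DoublySingular

open MvPowerSeries

/-! ### The formal fixed point and bounds on its iterates -/

section FixedPoint

variable {N : ℕ} (p α : ℕ) (L : Matrix (Fin N) (Fin N) ℂ)
  (g : Fin N → MvPowerSeries (Fin 2 ⊕ Fin N) ℂ)

/-- The family `(x, ε, y)` that is substituted for the variables of `F`. -/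
noncomputable def substFamily (y : Fin N → MvPowerSeries (Fin 2) ℂ) :
    Fin 2 ⊕ Fin N → MvPowerSeries (Fin 2) ℂ :=
  Sum.elim ![xVar, epsVar] y

/-- The differential operator `ε^α x^(p+1) ∂/∂x`. -/
noncomputable def singularDeriv (y : MvPowerSeries (Fin 2) ℂ) : MvPowerSeries (Fin 2) ℂ :=
  epsVar ^ α * xVar ^ (p + 1) * pderiv ℂ 0 y

/-- The map whose fixed points are the solutions of `y = L ε^α x^(p+1) ∂y/∂x + g(x, ε, y)`. -/
noncomputable def fixMap (y : Fin N → MvPowerSeries (Fin 2) ℂ) (j : Fin N) :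
    MvPowerSeries (Fin 2) ℂ :=
  ∑ l, L j l • singularDeriv p α (y l) + subst (substFamily y) (g j)

variable {p α L g}

theorem constantCoeff_substFamily {y : Fin N → MvPowerSeries (Fin 2) ℂ}
    (hy : ∀ j, constantCoeff (y j) = 0) (i : Fin 2 ⊕ Fin N) :
    constantCoeff (substFamily y i) = 0 := by
  rcases i with i | j
  · fin_cases i <;> simp [substFamily]
  · exact hy j

theorem hasSubst_substFamily {y : Fin N → MvPowerSeries (Fin 2) ℂ}
    (hy : ∀ j, constantCoeff (y j) = 0) : HasSubst (substFamily y) :=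
  hasSubst_of_constantCoeff_zero (constantCoeff_substFamily hy)

theorem constantCoeff_singularDeriv (y : MvPowerSeries (Fin 2) ℂ) :
    constantCoeff (singularDeriv p α y) = 0 := by
  simp [singularDeriv]

theorem constantCoeff_fixMap (hg : ∀ j, constantCoeff (g j) = 0)
    {y : Fin N → MvPowerSeries (Fin 2) ℂ} (hy : ∀ j, constantCoeff (y j) = 0) (j : Fin N) :
    constantCoeff (fixMap p α L g y j) = 0 := by
  rw [fixMap, map_add, constantCoeff_subst_eq_zero (hasSubst_substFamily hy)
    (constantCoeff_substFamily hy) (hg j), map_sum]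
  simp [constantCoeff_singularDeriv]

/-- The Euler derivation `x ∂/∂x` does not lower the order, and the remaining factor `ε^α x^p`
vanishes at the origin. -/
theorem add_one_le_order_singularDeriv_sub (hα : 1 ≤ α) {y z : MvPowerSeries (Fin 2) ℂ} {k : ℕ∞}
    (h : k ≤ (y - z).order) :
    k + 1 ≤ (singularDeriv p α y - singularDeriv p α z).order := by
  obtain ⟨a, rfl⟩ := Nat.exists_eq_add_of_le' hα
  have hX : k ≤ (X 0 * pderiv ℂ 0 (y - z)).order := by
    classical
    refine le_order fun d hd => ?_
    rw [X, coeff_monomial_mul]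
    split_ifs with hle
    · rw [coeff_pderiv, tsub_add_cancel_of_le hle, coeff_of_lt_order (hd.trans_le h)]
      simp
    · rfl
  have he : 1 ≤ (epsVar ^ a * xVar ^ p * epsVar).order := by
    rw [one_le_order_iff_constCoeff_eq_zero]
    simp
  have : singularDeriv p (a + 1) y - singularDeriv p (a + 1) z =
      (X 0 * pderiv ℂ 0 (y - z)) * (epsVar ^ a * xVar ^ p * epsVar) := by
    simp only [singularDeriv, map_sub]
    ring
  rw [this]
  exact (add_le_add hX he).trans le_order_mul

theorem add_one_le_order_fixMap_sub (hα : 1 ≤ α)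
    (hg : ∀ j l, coeff (Finsupp.single (Sum.inr l) 1) (g j) = 0)
    {y z : Fin N → MvPowerSeries (Fin 2) ℂ} (hy : ∀ j, constantCoeff (y j) = 0)
    (hz : ∀ j, constantCoeff (z j) = 0) {k : ℕ∞} (h : ∀ j, k ≤ (y j - z j).order) (j : Fin N) :
    k + 1 ≤ (fixMap p α L g y j - fixMap p α L g z j).order := by
  rw [fixMap, fixMap, add_sub_add_comm, ← Finset.sum_sub_distrib]
  refine le_order_add (le_order_sum _ fun l _ => ?_) ?_
  · rw [← smul_sub]
    exact (add_one_le_order_singularDeriv_sub hα (h l)).trans le_order_smul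
  · refine add_one_le_order_subst_sub (constantCoeff_substFamily hy)
      (constantCoeff_substFamily hz) ?_ _ ?_
    · rintro (i | l)
      · simp [substFamily]
      · exact h l
    · rintro (i | l)
      · exact Or.inl rfl
      · exact Or.inr (hg j l)

theorem constantCoeff_iterate_fixMap (hg : ∀ j, constantCoeff (g j) = 0) (n : ℕ) (j : Fin N) :
    constantCoeff ((fixMap p α L g)^[n] 0 j) = 0 := by
  induction n generalizing j with
  | zero => simp
  | succ n ih =>
    rw [Function.iterate_succ_apply']
    exact constantCoeff_fixMap hg ih j

/-- All iterates from the `n`-th on agree below degree `n`, so the coefficient at `d` is final at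
step `d.degree + 1`. The last clause lets norm bounds on iterates pass to the limit's coefficients.
-/
theorem exists_fixMap_eq (hα : 1 ≤ α) (hg0 : ∀ j, constantCoeff (g j) = 0)
    (hg : ∀ j l, coeff (Finsupp.single (Sum.inr l) 1) (g j) = 0) :
    ∃ y : Fin N → MvPowerSeries (Fin 2) ℂ, (∀ j, constantCoeff (y j) = 0) ∧
      fixMap p α L g y = y ∧
      ∀ d j, coeff d (y j) = coeff d ((fixMap p α L g)^[d.degree + 1] 0 j) := by
  set Φ := fixMap p α L g with hΦ
  have hc : ∀ n j, constantCoeff (Φ^[n] 0 j) = 0 := constantCoeff_iterate_fixMap hg0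
  have hstep : ∀ (n m : ℕ) j, (n : ℕ∞) ≤ (Φ^[n + m] 0 j - Φ^[n] 0 j).order := by
    intro n
    induction n with
    | zero => simp
    | succ n ih =>
      intro m j
      rw [Nat.add_right_comm, Function.iterate_succ_apply', Function.iterate_succ_apply',
        Nat.cast_succ]
      exact add_one_le_order_fixMap_sub hα hg (hc _) (hc _) (ih m) j
  let y : Fin N → MvPowerSeries (Fin 2) ℂ := fun j d => coeff d (Φ^[d.degree + 1] 0 j)
  have hy : ∀ d j, coeff d (y j) = coeff d (Φ^[d.degree + 1] 0 j) := fun d j => rfl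
  have hyc : ∀ j, constantCoeff (y j) = 0 := fun j => by
    rw [← coeff_zero_eq_constantCoeff_apply, hy, coeff_zero_eq_constantCoeff_apply]
    exact hc _ j
  have happrox : ∀ (n : ℕ) j, (n : ℕ∞) ≤ (y j - Φ^[n] 0 j).order := by
    intro n j
    refine nat_le_order fun d hd => ?_
    obtain ⟨m, rfl⟩ := Nat.exists_eq_add_of_lt hd
    rw [map_sub, hy, ← neg_sub, ← map_sub, Nat.add_right_comm, coeff_of_lt_order, neg_zero]
    refine lt_of_lt_of_le ?_ (hstep (d.degree + 1) m j)
    exact_mod_cast Nat.lt_succ_self _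
  refine ⟨y, hyc, ?_, hy⟩
  funext j
  rw [← sub_eq_zero, ← order_eq_top_iff]
  refine ENat.eq_top_iff_forall_ge.2 fun n => ?_
  rw [← sub_add_sub_cancel _ (Φ^[n + 1] 0 j)]
  refine le_order_add ?_ ?_
  · rw [Function.iterate_succ_apply']
    exact le_self_add.trans (add_one_le_order_fixMap_sub hα hg hyc (hc n) (happrox n) j)
  · rw [← order_neg, neg_sub]
    exact le_trans (by exact_mod_cast Nat.le_succ n) (happrox (n + 1) j)

theorem fixMap_eq_unique (hα : 1 ≤ α)
    (hg : ∀ j l, coeff (Finsupp.single (Sum.inr l) 1) (g j) = 0)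
    {y z : Fin N → MvPowerSeries (Fin 2) ℂ} (hy : ∀ j, constantCoeff (y j) = 0)
    (hz : ∀ j, constantCoeff (z j) = 0) (hy' : fixMap p α L g y = y)
    (hz' : fixMap p α L g z = z) : z = y := by
  have h : ∀ (n : ℕ) j, (n : ℕ∞) ≤ (z j - y j).order := by
    intro n
    induction n with
    | zero => simp
    | succ n ih =>
      intro j
      rw [← hy', ← hz', Nat.cast_succ]
      exact add_one_le_order_fixMap_sub hα hg hz hy ih j
  funext j
  rw [← sub_eq_zero, ← order_eq_top_iff]
  exact ENat.eq_top_iff_forall_ge.2 fun n => h n j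

/-- Every monomial of `g` contains `x` or `ε`, of size `η² R`, or two factors from `y`, each of size
`η R`. Either way `η²` splits off. -/
theorem truncNorm_subst_substFamily_le {ρ σ R η M : ℝ} {D : Fin 2 →₀ ℕ} (hρ : 0 ≤ ρ) (hσ : 0 ≤ σ)
    (hη : 0 ≤ η) (hη1 : η ≤ 1) (hρR : ρ ≤ η ^ 2 * R) (hσR : σ ≤ η ^ 2 * R)
    {g : MvPowerSeries (Fin 2 ⊕ Fin N) ℂ} (hg0 : constantCoeff g = 0)
    (hg : ∀ l, coeff (Finsupp.single (Sum.inr l) 1) g = 0) (hR : 0 ≤ R)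
    (hM : ∀ T : Finset (Fin 2 ⊕ Fin N →₀ ℕ), ∑ k ∈ T, ‖coeff k g‖ * R ^ k.degree ≤ M)
    {y : Fin N → MvPowerSeries (Fin 2) ℂ} (hy : ∀ j, constantCoeff (y j) = 0)
    (hyn : ∀ j, truncNorm ρ σ D (y j) ≤ η * R) :
    truncNorm ρ σ D (subst (substFamily y) g) ≤ η ^ 2 * M := by
  have h2 : η ^ 2 ≤ η := by nlinarith
  have h0 := fun f => truncNorm_nonneg (D := D) hρ hσ f
  have hx : ∀ i, truncNorm ρ σ D (substFamily y (Sum.inl i)) ≤ η ^ 2 * R := by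
    intro i
    fin_cases i
    · refine le_trans ?_ hρR
      simpa [X, substFamily] using truncNorm_monomial_le (D := D) hρ hσ (Finsupp.single 0 1) 1
    · refine le_trans ?_ hσR
      simpa [X, substFamily] using truncNorm_monomial_le (D := D) hρ hσ (Finsupp.single 1 1) 1
  have hall : ∀ i, truncNorm ρ σ D (substFamily y i) ≤ η * R := by
    rintro (i | l)
    · exact (hx i).trans (by gcongr)
    · exact hyn l
  have hallR : ∀ i, truncNorm ρ σ D (substFamily y i) ≤ R := fun i =>
    (hall i).trans (mul_le_of_le_one_left hR hη1)
  have hprodR : ∀ d : Fin 2 ⊕ Fin N →₀ ℕ,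
      ∏ i, truncNorm ρ σ D (substFamily y i) ^ d i ≤ R ^ d.degree := by
    intro d
    rw [Finsupp.degree_eq_sum, ← Finset.prod_pow_eq_pow_sum]
    exact Finset.prod_le_prod (fun i _ => pow_nonneg (h0 _) _)
      fun i _ => pow_le_pow_left₀ (h0 _) (hallR i) _
  have hprod0 : ∀ d : Fin 2 ⊕ Fin N →₀ ℕ,
      0 ≤ ∏ i, truncNorm ρ σ D (substFamily y i) ^ d i :=
    fun d => Finset.prod_nonneg fun i _ => pow_nonneg (h0 _) _
  refine truncNorm_subst_le hρ hσ (hasSubst_substFamily hy) g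
    (b := fun k => η ^ 2 * (‖coeff k g‖ * R ^ k.degree)) (fun T => ?_) fun k => ?_
  · rw [← Finset.mul_sum]
    gcongr
    exact hM T
  · rw [mul_left_comm]
    rcases eq_zero_or_exists_eq_single_add k with rfl | ⟨i, k', rfl⟩
    · simp [hg0]
    rw [prod_pow_single_add, map_add, Finsupp.degree_single, pow_add, pow_one]
    rcases i with i | l
    · refine mul_le_mul_of_nonneg_left ?_ (norm_nonneg _)
      calc _ ≤ (η ^ 2 * R) * R ^ k'.degree :=
            mul_le_mul (hx i) (hprodR k') (hprod0 _) (by positivity)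
        _ = _ := by ring
    rcases eq_zero_or_exists_eq_single_add k' with rfl | ⟨i', k'', rfl⟩
    · simp [hg l]
    refine mul_le_mul_of_nonneg_left ?_ (norm_nonneg _)
    rw [prod_pow_single_add, map_add, Finsupp.degree_single, pow_add, pow_one]
    calc _ ≤ (η * R) * ((η * R) * R ^ k''.degree) :=
          mul_le_mul (hall _) (mul_le_mul (hall _) (hprodR _) (hprod0 _) (by positivity))
            (mul_nonneg (h0 _) (hprod0 _)) (by positivity)
      _ = _ := by ring

/-- If the weights are small compared with `D 0`, all iterates of `fixMap` stay in a small ball. -/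
theorem truncNorm_iterate_fixMap_le {ρ σ R η M : ℝ} {D : Fin 2 →₀ ℕ} (hρ : 0 ≤ ρ) (hσ : 0 ≤ σ)
    (hη : 0 ≤ η) (hη1 : η ≤ 1) (hρR : ρ ≤ η ^ 2 * R) (hσR : σ ≤ η ^ 2 * R)
    (hg0 : ∀ j, constantCoeff (g j) = 0)
    (hg : ∀ j l, coeff (Finsupp.single (Sum.inr l) 1) (g j) = 0) (hR : 0 ≤ R)
    (hM : ∀ j (T : Finset (Fin 2 ⊕ Fin N →₀ ℕ)), ∑ k ∈ T, ‖coeff k (g j)‖ * R ^ k.degree ≤ M)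
    (hηM : η * M ≤ R / 2) (hL : ∀ j, (∑ l, ‖L j l‖) * (D 0 * (ρ ^ p * σ ^ α)) ≤ 1 / 2)
    (n : ℕ) (j : Fin N) :
    truncNorm ρ σ D ((fixMap p α L g)^[n] 0 j) ≤ η * R := by
  induction n generalizing j with
  | zero =>
    simp only [Function.iterate_zero, id, Pi.zero_apply, truncNorm_zero]
    positivity
  | succ n ih =>
    rw [Function.iterate_succ_apply', fixMap]
    refine (truncNorm_add_le hρ hσ _ _).trans ?_
    have h1 := truncNorm_subst_substFamily_le hρ hσ hη hη1 hρR hσR (hg0 j) (hg j) hR (hM j)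
      (constantCoeff_iterate_fixMap (p := p) (α := α) (L := L) hg0 n) ih
    have h2 : truncNorm ρ σ D (∑ l, L j l • singularDeriv p α ((fixMap p α L g)^[n] 0 l)) ≤
        (∑ l, ‖L j l‖) * (D 0 * (ρ ^ p * σ ^ α)) * (η * R) := by
      refine (truncNorm_sum_le hρ hσ _ _).trans ?_
      rw [Finset.sum_mul, Finset.sum_mul]
      refine Finset.sum_le_sum fun l _ => ?_
      rw [truncNorm_smul, mul_assoc]
      refine mul_le_mul_of_nonneg_left ?_ (norm_nonneg _)
      exact (truncNorm_singular_le hρ hσ p α _).trans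
        (mul_le_mul_of_nonneg_left (ih l) (by positivity))
    -- The derivative and the substitution each use up at most half of the radius `η R`.
    have h3 := mul_le_mul_of_nonneg_right (hL j) (mul_nonneg hη hR)
    have h4 := mul_le_mul_of_nonneg_left hηM hη
    nlinarith

end FixedPoint

/-! ### The Gevrey estimate -/

/-- This is `t^m / m! ≤ e^t` at `t = n + 1`, raised to the power `1/q ≤ 1`. -/
theorem rpow_natCast_add_one_le (n m : ℕ) {q : ℕ} (hq : 1 ≤ q) :
    (((n : ℝ) + 1) ^ (1 / (q : ℝ))) ^ m ≤
      (m ! : ℝ) ^ (1 / (q : ℝ)) * Real.exp (n + 1) := by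
  have hq' : (1 : ℝ) ≤ q := by exact_mod_cast hq
  have h1 : ((n : ℝ) + 1) ^ m ≤ m ! * Real.exp (n + 1) := by
    have := Real.pow_div_factorial_le_exp (x := (n : ℝ) + 1) (by positivity) m
    rwa [div_le_iff₀ (by positivity), mul_comm] at this
  rw [← Real.rpow_natCast, ← Real.rpow_mul (by positivity), mul_comm (1 / (q : ℝ)),
    Real.rpow_mul (by positivity), Real.rpow_natCast]
  refine (Real.rpow_le_rpow (by positivity) h1 (by positivity)).trans ?_
  rw [Real.mul_rpow (by positivity) (by positivity)]
  gcongr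
  rw [← Real.exp_mul]
  refine Real.exp_le_exp.2 (mul_le_of_le_one_right (by positivity) ?_)
  rw [div_le_one (by positivity)]
  exact hq'

/-- The fixed point of `fixMap` has coefficients of monomial Gevrey type. -/
theorem isMonomialGevrey_of_fixMap {N p α : ℕ} (hp : 1 ≤ p) (hα : 1 ≤ α)
    {L : Matrix (Fin N) (Fin N) ℂ} {g : Fin N → MvPowerSeries (Fin 2 ⊕ Fin N) ℂ}
    (hg0 : ∀ j, constantCoeff (g j) = 0)
    (hg : ∀ j l, coeff (Finsupp.single (Sum.inr l) 1) (g j) = 0) {R : ℝ} (hR : 0 < R)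
    (hs : ∀ j, Summable fun k => ‖coeff k (g j)‖ * R ^ k.degree)
    {y : Fin N → MvPowerSeries (Fin 2) ℂ}
    (hy : ∀ d j, coeff d (y j) = coeff d ((fixMap p α L g)^[d.degree + 1] 0 j)) :
    IsMonomialGevrey p α y := by
  obtain ⟨M, hM0, hM⟩ : ∃ M : ℝ, 0 ≤ M ∧ ∀ j (T : Finset (Fin 2 ⊕ Fin N →₀ ℕ)),
      ∑ k ∈ T, ‖coeff k (g j)‖ * R ^ k.degree ≤ M := by
    have h0 : ∀ j, 0 ≤ ∑' k, ‖coeff k (g j)‖ * R ^ k.degree :=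
      fun j => tsum_nonneg fun k => by positivity
    refine ⟨∑ j, ∑' k, ‖coeff k (g j)‖ * R ^ k.degree, Finset.sum_nonneg fun j _ => h0 j,
      fun j T => ((hs j).sum_le_tsum T fun k _ => by positivity).trans ?_⟩
    exact Finset.single_le_sum (f := fun j => ∑' k, ‖coeff k (g j)‖ * R ^ k.degree)
      (fun j _ => h0 j) (Finset.mem_univ j)
  obtain ⟨Λ, hΛ0, hΛ⟩ : ∃ Λ : ℝ, 0 ≤ Λ ∧ ∀ j, ∑ l, ‖L j l‖ ≤ Λ :=
    ⟨∑ j, ∑ l, ‖L j l‖, by positivity, fun j =>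
      Finset.single_le_sum (f := fun j => ∑ l, ‖L j l‖) (fun j _ => by positivity)
        (Finset.mem_univ j)⟩
  -- the radius of the ball that is mapped to itself
  obtain ⟨η, hη, hη1, hηM, hηR, hηΛ⟩ : ∃ η : ℝ, 0 < η ∧ η ≤ 1 ∧ η * M ≤ R / 2 ∧ η * R ≤ 1 ∧
      Λ * (η * R) ≤ 1 / 2 := by
    -- With `η` the inverse of this sum, `η` times each summand is at most `1`, which yields the
    -- four upper bounds.
    have hK : 0 < 1 + R + 2 * M / R + 2 * Λ * R := by positivity
    have hinv : (1 + R + 2 * M / R + 2 * Λ * R)⁻¹ * (1 + R + 2 * M / R + 2 * Λ * R) = 1 :=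
      inv_mul_cancel₀ hK.ne'
    set η := (1 + R + 2 * M / R + 2 * Λ * R)⁻¹
    have hη : 0 < η := inv_pos.2 hK
    have hMR : 0 ≤ η * (2 * M / R) := by positivity
    have hΛR : 0 ≤ η * (2 * Λ * R) := by positivity
    have hηR : 0 ≤ η * R := by positivity
    refine ⟨η, hη, by linarith, ?_, by linarith, by linarith⟩
    have : η * (2 * M / R) ≤ 1 := by linarith
    rw [← mul_div_assoc, div_le_one hR] at this
    linarith
  set r := η ^ 2 * R with hr
  have hr0 : 0 < r := by positivity
  have hrη : r ≤ η * R := by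
    rw [hr]
    gcongr
    nlinarith
  have hr1 : r ≤ 1 := hrη.trans hηR
  have hbound : ∀ (n m : ℕ) (ρ σ : ℝ), 0 < ρ → 0 < σ → ρ ≤ r → σ ≤ r →
      (n + 1) * (ρ ^ p * σ ^ α) ≤ r → ∀ j,
      ‖coeff (Finsupp.single 0 n + Finsupp.single 1 m) (y j)‖ * (ρ ^ n * σ ^ m) ≤ η * R := by
    intro n m ρ σ hρ hσ hρr hσr hρσ j
    set D : Fin 2 →₀ ℕ := Finsupp.single 0 n + Finsupp.single 1 m with hD
    have hD0 : D 0 = n := by simp [hD]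
    have hD1 : D 1 = m := by simp [hD]
    have h := norm_coeff_mul_le_truncNorm (D := D) hρ.le hσ.le
      ((fixMap p α L g)^[D.degree + 1] 0 j)
    rw [← hy, hD0, hD1] at h
    refine h.trans (truncNorm_iterate_fixMap_le hρ.le hσ.le hη.le hη1 hρr hσr hg0 hg hR.le hM hηM
      (fun j => ?_) _ j)
    rw [hD0]
    refine (mul_le_mul (hΛ j) (le_trans ?_ (hρσ.trans hrη)) (by positivity) hΛ0).trans hηΛ
    gcongr
    linarith
  -- One variable alone absorbs the loss `n`: the `q`-th power of its weight is `r^q / (n+1)`. Using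
  -- `n + 1` also covers `n = 0`.
  have hweight : ∀ (n q q' : ℕ), 1 ≤ q → 1 ≤ q' →
      0 < r / ((n : ℝ) + 1) ^ (1 / (q : ℝ)) ∧ r / ((n : ℝ) + 1) ^ (1 / (q : ℝ)) ≤ r ∧
      (n + 1) * ((r / ((n : ℝ) + 1) ^ (1 / (q : ℝ))) ^ q * r ^ q') ≤ r := by
    intro n q q' hq hq'
    have hn : (0 : ℝ) < (n : ℝ) + 1 := by positivity
    have h1 : 1 ≤ ((n : ℝ) + 1) ^ (1 / (q : ℝ)) :=
      Real.one_le_rpow (by linarith [Nat.cast_nonneg (α := ℝ) n]) (by positivity)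
    refine ⟨by positivity, div_le_self hr0.le h1, ?_⟩
    rw [div_pow, ← Real.rpow_natCast (((n : ℝ) + 1) ^ (1 / (q : ℝ))) q,
      ← Real.rpow_mul hn.le, one_div_mul_cancel (by positivity), Real.rpow_one]
    calc ((n : ℝ) + 1) * (r ^ q / (n + 1) * r ^ q') = r ^ q * r ^ q' := by field_simp
      _ ≤ 1 * r ^ 1 := by
        refine mul_le_mul (pow_le_one₀ hr0.le hr1) (pow_le_pow_of_le_one hr0.le hr1 hq')
          (by positivity) zero_le_one
      _ = r := by ring
  have hexp : ∀ n m : ℕ, Real.exp (n + 1) ≤ Real.exp 1 * Real.exp 1 ^ (n + m) := by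
    intro n m
    rw [← Real.exp_nat_mul, ← Real.exp_add, Real.exp_le_exp]
    push_cast
    linarith [Nat.cast_nonneg (α := ℝ) m]
  have hsolve : ∀ (n m : ℕ) (c S f : ℝ), 0 < S → c * (r ^ (n + m) / S) ≤ η * R →
      S ≤ f * Real.exp (n + 1) → 0 ≤ f →
      c ≤ η * R * Real.exp 1 * (Real.exp 1 / r) ^ (n + m) * f := by
    intro n m c S f hS hc hSf hf
    rw [← mul_div_assoc, div_le_iff₀ hS, ← le_div_iff₀ (by positivity)] at hc
    refine hc.trans ?_
    rw [div_pow, div_le_iff₀ (by positivity)]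
    calc η * R * S ≤ η * R * (f * (Real.exp 1 * Real.exp 1 ^ (n + m))) := by
          gcongr
          exact hSf.trans (by gcongr; exact hexp n m)
      _ = _ := by field_simp
  refine ⟨η * R * Real.exp 1, Real.exp 1 / r, by positivity, by positivity, fun n m => ?_⟩
  rw [mul_min_of_nonneg _ _ (by positivity)]
  refine (pi_norm_le_iff_of_nonneg (by positivity)).2 fun j => le_min ?_ ?_
  · obtain ⟨h1, h2, h3⟩ := hweight n p α hp hα
    have h := hbound n m _ r h1 hr0 h2 le_rfl h3 j
    refine hsolve n m _ ((((n : ℝ) + 1) ^ (1 / (p : ℝ))) ^ n) _ (by positivity) ?_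
      (rpow_natCast_add_one_le n n hp) (by positivity)
    refine le_of_eq_of_le ?_ h
    rw [div_pow, pow_add, coeffVec]
    ring
  -- The loss is still the `x`-degree `n`, so the `ε`-weight depends on `n` although its exponent is
  -- `m`.
  · obtain ⟨h1, h2, h3⟩ := hweight n α p hα hp
    have h := hbound n m r _ hr0 h1 le_rfl h2 (by rwa [mul_comm (r ^ p)]) j
    refine hsolve n m _ ((((n : ℝ) + 1) ^ (1 / (α : ℝ))) ^ m) _ (by positivity) ?_
      (rpow_natCast_add_one_le n m hα) (by positivity)
    refine le_of_eq_of_le ?_ h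
    rw [div_pow, pow_add, coeffVec]
    ring

/-! ### Reduction of the system to the fixed-point equation -/

section Linearization

variable {N : ℕ}

/-- The part of the system that remains after its linear part in `y` has been inverted by `L`. -/
noncomputable def residual (L : Matrix (Fin N) (Fin N) ℂ)
    (f : Fin N → MvPowerSeries (Fin 2 ⊕ Fin N) ℂ) (j : Fin N) :
    MvPowerSeries (Fin 2 ⊕ Fin N) ℂ :=
  X (Sum.inr j) - ∑ l, L j l • f l

theorem subst_residual (L : Matrix (Fin N) (Fin N) ℂ)
    (f : Fin N → MvPowerSeries (Fin 2 ⊕ Fin N) ℂ) {y : Fin N → MvPowerSeries (Fin 2) ℂ}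
    (hy : ∀ j, constantCoeff (y j) = 0) (j : Fin N) :
    subst (substFamily y) (residual L f j) =
      y j - ∑ l, L j l • subst (substFamily y) (f l) := by
  have h := hasSubst_substFamily hy
  rw [← coe_substAlgHom h, residual, map_sub, map_sum]
  simp only [map_smul, coe_substAlgHom h, subst_X h]
  rfl

/-- The difference `fixMap y - y` is `L` applied to the defect of the system, and `A` undoes `L`. -/
theorem fixMap_residual_eq_iff {p α : ℕ} {L A : Matrix (Fin N) (Fin N) ℂ} (hAL : A * L = 1)
    (f : Fin N → MvPowerSeries (Fin 2 ⊕ Fin N) ℂ) {y : Fin N → MvPowerSeries (Fin 2) ℂ}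
    (hy : ∀ j, constantCoeff (y j) = 0) :
    fixMap p α L (residual L f) y = y ↔
      ∀ j, singularDeriv p α (y j) = subst (substFamily y) (f j) := by
  have key : ∀ j, fixMap p α L (residual L f) y j = y j +
      ∑ l, L j l • (singularDeriv p α (y l) - subst (substFamily y) (f l)) := by
    intro j
    rw [fixMap, subst_residual L f hy]
    simp only [smul_sub, Finset.sum_sub_distrib]
    ring
  constructor
  · intro h j
    have h0 : ∀ i, ∑ l, L i l • (singularDeriv p α (y l) - subst (substFamily y) (f l)) = 0 := by
      intro i
      have := key i
      rwa [h, left_eq_add] at this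
    rw [← sub_eq_zero]
    calc singularDeriv p α (y j) - subst (substFamily y) (f j)
        = ∑ l, (A * L) j l • (singularDeriv p α (y l) - subst (substFamily y) (f l)) := by
          simp [hAL, Matrix.one_apply]
      _ = ∑ i, A j i •
          ∑ l, L i l • (singularDeriv p α (y l) - subst (substFamily y) (f l)) := by
          simp only [Matrix.mul_apply, Finset.sum_smul, Finset.smul_sum, mul_smul]
          exact Finset.sum_comm
      _ = 0 := by simp [h0]
  · intro h
    funext j
    rw [key]
    simp [h]

theorem constantCoeff_residual {L : Matrix (Fin N) (Fin N) ℂ}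
    {f : Fin N → MvPowerSeries (Fin 2 ⊕ Fin N) ℂ} (hf : ∀ j, constantCoeff (f j) = 0)
    (j : Fin N) : constantCoeff (residual L f j) = 0 := by
  simp [residual, hf]

/-- The `y`-linear part of `L f` is `L A = 1`, which cancels the variable `y_j`. -/
theorem coeff_single_inr_residual {L A : Matrix (Fin N) (Fin N) ℂ} (hLA : L * A = 1)
    {f : Fin N → MvPowerSeries (Fin 2 ⊕ Fin N) ℂ}
    (hf : ∀ j l, coeff (Finsupp.single (Sum.inr l) 1) (f j) = A j l) (j l : Fin N) :
    coeff (Finsupp.single (Sum.inr l) 1) (residual L f j) = 0 := by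
  classical
  have h : ∑ i, L j i * A i l = (1 : Matrix (Fin N) (Fin N) ℂ) j l := by
    rw [← hLA, Matrix.mul_apply]
  simp [residual, hf, h, coeff_X, Matrix.one_apply, Finsupp.single_left_inj, eq_comm]

theorem summable_norm_coeff_residual {L : Matrix (Fin N) (Fin N) ℂ}
    {f : Fin N → MvPowerSeries (Fin 2 ⊕ Fin N) ℂ} {R : ℝ} (hR : 0 ≤ R)
    (hf : ∀ j, Summable fun k => ‖coeff k (f j)‖ * R ^ k.degree) (j : Fin N) :
    Summable fun k => ‖coeff k (residual L f j)‖ * R ^ k.degree := by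
  classical
  have hX : Summable fun k => ‖coeff k (X (Sum.inr j) : MvPowerSeries (Fin 2 ⊕ Fin N) ℂ)‖ *
      R ^ k.degree := by
    refine summable_of_ne_finset_zero (s := {Finsupp.single (Sum.inr j) 1}) fun k hk => ?_
    rw [coeff_X, if_neg (by simpa using hk)]
    simp
  refine Summable.of_nonneg_of_le (fun k => by positivity) (fun k => ?_)
    (hX.add (summable_sum (s := Finset.univ) fun l _ => (hf l).mul_left ‖L j l‖))
  have : ‖coeff k (residual L f j)‖ ≤
      ‖coeff k (X (Sum.inr j) : MvPowerSeries (Fin 2 ⊕ Fin N) ℂ)‖ +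
        ∑ l, ‖L j l‖ * ‖coeff k (f l)‖ := by
    rw [residual, map_sub, map_sum]
    refine (norm_sub_le _ _).trans (add_le_add le_rfl ((norm_sum_le _ _).trans_eq ?_))
    simp
  refine (mul_le_mul_of_nonneg_right this (by positivity)).trans_eq ?_
  simp only [add_mul, Finset.sum_mul, mul_assoc]

end Linearization

theorem norm_coordVec_le (N : ℕ) (i : Fin 2 ⊕ Fin N) : ‖coordVec N i‖ ≤ 1 := by
  rcases i with i | j
  · fin_cases i <;> simp [coordVec, Prod.norm_def]
  · have : ‖(Pi.single j 1 : Fin N → ℂ)‖ ≤ 1 := by simp [Pi.norm_single]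
    simpa [coordVec, Prod.norm_def] using this

theorem isFormalSolution_iff {N p α : ℕ} {F : ℂ × ℂ × (Fin N → ℂ) → (Fin N → ℂ)}
    {y : Fin N → MvPowerSeries (Fin 2) ℂ} :
    IsFormalSolution p α F y ↔ (∀ j, constantCoeff (y j) = 0) ∧ ∀ j,
      singularDeriv p α (y j) =
        subst (substFamily y) (taylorSeries (coordVec N) fun z => F z j) :=
  ⟨fun h => ⟨h.1, h.2⟩, fun h => ⟨h.1, h.2⟩⟩

end DoublySingular

theorem mainTheorem4 (N p α : ℕ) (hp : 1 ≤ p) (hα : 1 ≤ α)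
    (F : ℂ × ℂ × (Fin N → ℂ) → (Fin N → ℂ))
    (hF : AnalyticAt ℂ F (0, 0, 0)) (hF0 : F (0, 0, 0) = 0)
    (hDF : (fderiv ℂ (fun y : Fin N → ℂ => F (0, 0, y)) 0).IsInvertible) :
    ∃ y : Fin N → MvPowerSeries (Fin 2) ℂ,
      DoublySingular.IsFormalSolution p α F y ∧
      (∀ z : Fin N → MvPowerSeries (Fin 2) ℂ, DoublySingular.IsFormalSolution p α F z → z = y) ∧
      DoublySingular.IsMonomialGevrey p α y := by
  open DoublySingular in
  obtain ⟨e, he⟩ := hDF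
  let A : Matrix (Fin N) (Fin N) ℂ := LinearMap.toMatrix' (e : (Fin N → ℂ) →ₗ[ℂ] (Fin N → ℂ))
  let L : Matrix (Fin N) (Fin N) ℂ :=
    LinearMap.toMatrix' (e.symm : (Fin N → ℂ) →ₗ[ℂ] (Fin N → ℂ))
  have hAL : A * L = 1 := by
    rw [← LinearMap.toMatrix'_comp, ← LinearMap.toMatrix'_id]
    congr 1
    ext
    simp
  have hLA : L * A = 1 := mul_eq_one_comm.1 hAL
  have hFj : ∀ j, AnalyticAt ℂ (fun z => F z j) 0 := fun j =>
    ((ContinuousLinearMap.proj j : (Fin N → ℂ) →L[ℂ] ℂ).analyticAt _).comp hF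
  let f : Fin N → MvPowerSeries (Fin 2 ⊕ Fin N) ℂ := fun j =>
    taylorSeries (coordVec N) fun z => F z j
  have hf0 : ∀ j, MvPowerSeries.constantCoeff (f j) = 0 := fun j =>
    (taylorCoeff_zero _ _).trans (congrFun hF0 j)
  -- The Taylor coefficient uses the full derivative of `F`; the chain rule along `y ↦ (0, 0, y)`
  -- turns it into an entry of the partial Jacobian.
  have hf1 : ∀ j l, MvPowerSeries.coeff (Finsupp.single (Sum.inr l) 1) (f j) = A j l := by
    intro j l
    refine (taylorCoeff_single _ _ _).trans ?_
    have hd : HasFDerivAt F (fderiv ℂ F 0) ((0 : ℂ), (0 : ℂ), (0 : Fin N → ℂ)) :=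
      hF.differentiableAt.hasFDerivAt
    have hi : HasFDerivAt (fun y : Fin N → ℂ => ((0 : ℂ), (0 : ℂ), y))
        ((ContinuousLinearMap.inr ℂ ℂ (ℂ × (Fin N → ℂ))).comp
          (ContinuousLinearMap.inr ℂ ℂ (Fin N → ℂ))) 0 :=
      ((ContinuousLinearMap.inr ℂ ℂ (ℂ × (Fin N → ℂ))).comp
          (ContinuousLinearMap.inr ℂ ℂ (Fin N → ℂ))).hasFDerivAt
    have hc := (hd.comp (0 : Fin N → ℂ) hi).fderiv
    have hj := (hasFDerivAt_pi'.1 hd j).fderiv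
    have hA : A j l = (e : (Fin N → ℂ) →L[ℂ] (Fin N → ℂ)) (Pi.single l 1) j :=
      LinearMap.toMatrix'_apply (e : (Fin N → ℂ) →ₗ[ℂ] (Fin N → ℂ)) j l
    rw [hA, he]
    refine (congrArg (fun T => T (coordVec N (Sum.inr l))) hj).trans ?_
    exact (congrArg (fun T => T (Pi.single l 1) j) hc).symm
  obtain ⟨R, hR, hs⟩ := exists_summable_norm_taylorCoeff (norm_coordVec_le N) hFj
  have hg0 := constantCoeff_residual (L := L) hf0
  have hg1 := coeff_single_inr_residual hLA hf1
  obtain ⟨y, hy0, hy, hcoeff⟩ := exists_fixMap_eq (p := p) (L := L) hα hg0 hg1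
  refine ⟨y, isFormalSolution_iff.2 ⟨hy0, (fixMap_residual_eq_iff hAL f hy0).1 hy⟩, ?_, ?_⟩
  · intro z hz
    obtain ⟨hz0, hz⟩ := isFormalSolution_iff.1 hz
    exact fixMap_eq_unique hα hg1 hy0 hz0 hy ((fixMap_residual_eq_iff hAL f hz0).2 hz)
  · exact isMonomialGevrey_of_fixMap hp hα hg0 hg1 hR
      (summable_norm_coeff_residual hR.le hs) hcoeff
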